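/- **Setting.** Let $n\ge 1$, $k\ge 0$. For $a=(a_{x,i},a_{z,i})_{i\le n}\in\mathbb Z_2^{2n}$ let $P_a=\bigotimes_{i=1}^n \mathrm i^{a_{x,i}a_{z,i}}X^{a_{x,i}}Z^{a_{z,i}}$ be the corresponding $n$-qubit Pauli operator and $\langle a,b\rangle=\sum_i(a_{x,i}b_{z,i}+a_{z,i}b_{x,i})\bmod 2$. A Pauli channel is a map $\Lambda(\rho)=\sum_a p_aP_a\rho P_a$ with $(p_a)_a$ a probability vector; its Pauli eigenvalues are $\lambda_b=\sum_a p_a(-1)^{\langle a,b\rangle}$. *Protocols.* An adaptive concatenating protocol with $k$ ancilla qubits consists of finitely many rounds. In a round it prepares a state $\rho$ of the $n$ working and $k$ ancilla qubits, alternately applies the unknown channel $\Lambda\otimes\mathrm{id}$ (acting on the working qubits) and quantum channels $\mathcal C_1,\dots,\mathcal C_m$ of its choice on all $n+k$ qubits, i.e. it produces $\mathcal C_m(\Lambda\otimes\mathrm{id}(\cdots\mathcal C_1(\Lambda\otimes\mathrm{id}(\rho))\cdots))$ with $m\ge 0$ queries, and then measures a finite-outcome POVM on all $n+k$ qubits.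 Whether there is a further round, and the state, the number $m$ of queries, the channels and the POVM of that round, may depend on all earlier outcomes. At the end the protocol outputs an answer that is a function of all outcomes. Its number of queries is the maximum, over all sequences of outcomes, of the total number of uses of $\Lambda$. *Tasks.* - The protocol solves *Pauli eigenvalue estimation* to error $\varepsilon$ with probability at least $\delta$ if for every Pauli channel, with probability at least $\delta$, it outputs estimates $(\hat\lambda_b)_b$ with $\max_b|\hat\lambda_b-\lambda_b|<\varepsilon$. - It solves *Pauli spike detection* with probability at least $\delta$ if it decides correctly, with probability at least $\delta$, which of the following two equally likely cases holds: the unknown channel is $\Lambda_{\mathrm{dep}}(\rho)=2^{-n}\operatorname{Tr}(\rho)\,I$; or it is $\Lambda_a(\rho)=2^{-n}\big(\operatorname{Tr}(\rho)\,I+\operatorname{Tr}(P_a\rho)\,P_a\big)$ with $a$ uniformly random in $\mathbb Z_2^{2n}\setminus\{0\}$. **Theorem.** For every $\delta>1/2$ there is a constant $c>0$, depending only on $\delta$, such that for all $n\ge 1$ and $k\ge 0$: 1. for every $0<\varepsilon\le 1$, every (possibly adaptive and concatenating) protocol with $k$ ancilla qubits that solves Pauli eigenvalue estimation to error $\varepsilon$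 with probability at least $\delta$ makes at least $c\,2^{(n-k)/3}$ queries to the unknown channel; 2. every such protocol that solves Pauli spike detection with probability at least $\delta$ makes at least $c\,2^{(n-k)/3}$ queries to the unknown channel. -/

import Mathlib

noncomputable section

namespace PauliLearning

open scoped Matrix ComplexOrder

/-! ### Finite-dimensional quantum mechanics -/

/-- Computational basis labels of `n` qubits. -/
abbrev Qubits (n : ℕ) : Type := Fin n → Fin 2

/-- Basis labels of `n` working qubits together with `k` ancilla qubits. -/
abbrev Sys (n k : ℕ) : Type := Qubits n × Qubits k

/-- Density matrices on the Hilbert space with orthonormal basis `I`. -/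
structure DensityMatrix (I : Type) [Fintype I] where
  mat : Matrix I I ℂ
  posSemidef : mat.PosSemidef
  trace_eq_one : mat.trace = 1

/-- `ampliate A Φ` is the map `Φ ⊗ id` on matrices over `I × A`: it applies `Φ` to every block of
the matrix that is obtained by fixing the two `A`-indices. -/
def ampliate {I : Type} (A : Type) (Φ : Matrix I I ℂ →ₗ[ℂ] Matrix I I ℂ) :
    Matrix (I × A) (I × A) ℂ →ₗ[ℂ] Matrix (I × A) (I × A) ℂ where
  toFun X := Matrix.of fun s t =>
    Φ (Matrix.of fun i j => X (i, s.2) (j, t.2)) s.1 t.1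
  map_add' X Y := by
    ext s t
    have h : (Matrix.of fun i j => (X + Y) (i, s.2) (j, t.2)) =
        (Matrix.of fun i j => X (i, s.2) (j, t.2)) +
          (Matrix.of fun i j => Y (i, s.2) (j, t.2)) := by
      ext i j; simp
    rw [Matrix.of_apply, h, map_add]
    rfl
  map_smul' c X := by
    ext s t
    have h : (Matrix.of fun i j => (c • X) (i, s.2) (j, t.2)) =
        c • (Matrix.of fun i j => X (i, s.2) (j, t.2)) := by
      ext i j; simp
    rw [Matrix.of_apply, h, map_smul]
    rfl

/-- Quantum channels on the space with basis `I`: completely positive trace-preserving maps. -/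
structure QuantumChannel (I : Type) [Fintype I] where
  map : Matrix I I ℂ →ₗ[ℂ] Matrix I I ℂ
  completelyPositive : ∀ (d : ℕ) (X : Matrix (I × Fin d) (I × Fin d) ℂ),
    X.PosSemidef → (ampliate (Fin d) map X).PosSemidef
  tracePreserving : ∀ X : Matrix I I ℂ, (map X).trace = X.trace

/-- POVMs with outcomes `0, …, r - 1`. -/
structure POVM (I : Type) [Fintype I] [DecidableEq I] (r : ℕ) where
  effect : Fin r → Matrix I I ℂ
  posSemidef : ∀ j, (effect j).PosSemidef
  sum_eq_one : ∑ j, effect j = 1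

/-! ### Pauli operators and Pauli channels -/

/-- `ℤ₂²ⁿ`: the entry `a i = (x, z)` holds the two bits of `a` at qubit `i`. -/
abbrev PauliIndex (n : ℕ) : Type := Fin n → ZMod 2 × ZMod 2

/-- The single-qubit operator `i ^ (x z) X ^ x Z ^ z`. -/
def pauli₁ (a : ZMod 2 × ZMod 2) : Matrix (Fin 2) (Fin 2) ℂ :=
  Complex.I ^ (a.1.val * a.2.val) •
    ((!![0, 1; 1, 0] : Matrix (Fin 2) (Fin 2) ℂ) ^ a.1.val *
      (!![1, 0; 0, -1] : Matrix (Fin 2) (Fin 2) ℂ) ^ a.2.val)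

/-- The `n`-qubit Pauli operator `P_a`, the tensor product of the `pauli₁ (a i)`. -/
def pauli {n : ℕ} (a : PauliIndex n) : Matrix (Qubits n) (Qubits n) ℂ :=
  Matrix.of fun s t => ∏ i, pauli₁ (a i) (s i) (t i)

/-- The symplectic form `⟨a, b⟩` on `ℤ₂²ⁿ`. -/
def symplectic {n : ℕ} (a b : PauliIndex n) : ZMod 2 :=
  ∑ i, ((a i).1 * (b i).2 + (a i).2 * (b i).1)

/-- The Pauli channel `ρ ↦ ∑ₐ pₐ Pₐ ρ Pₐ` with error rates `p`. -/
def pauliChannel {n : ℕ} (p : PauliIndex n → ℝ) :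
    Matrix (Qubits n) (Qubits n) ℂ →ₗ[ℂ] Matrix (Qubits n) (Qubits n) ℂ :=
  ∑ a, (p a : ℂ) • (LinearMap.mulRight ℂ (pauli a) ∘ₗ LinearMap.mulLeft ℂ (pauli a))

/-- The Pauli eigenvalues `λ_b = ∑ₐ pₐ (-1) ^ ⟨a, b⟩` of the Pauli channel with error rates `p`. -/
def pauliEigenvalue {n : ℕ} (p : PauliIndex n → ℝ) (b : PauliIndex n) : ℝ :=
  ∑ a, p a * (-1) ^ (symplectic a b).val

/-- The completely depolarizing channel `ρ ↦ 2⁻ⁿ Tr(ρ) I`. -/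
def depolarizing (n : ℕ) :
    Matrix (Qubits n) (Qubits n) ℂ →ₗ[ℂ] Matrix (Qubits n) (Qubits n) ℂ :=
  ((2 : ℂ) ^ n)⁻¹ • (Matrix.traceLinearMap (Qubits n) ℂ ℂ).smulRight 1

/-- The spiked channel `ρ ↦ 2⁻ⁿ (Tr(ρ) I + Tr(Pₐ ρ) Pₐ)`. -/
def spiked {n : ℕ} (a : PauliIndex n) :
    Matrix (Qubits n) (Qubits n) ℂ →ₗ[ℂ] Matrix (Qubits n) (Qubits n) ℂ :=
  ((2 : ℂ) ^ n)⁻¹ • ((Matrix.traceLinearMap (Qubits n) ℂ ℂ).smulRight 1 +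
    (Matrix.traceLinearMap (Qubits n) ℂ ℂ ∘ₗ LinearMap.mulLeft ℂ (pauli a)).smulRight (pauli a))

/-! ### Adaptive concatenating protocols with `k` ancilla qubits -/

/-- Adaptive, concatenating protocols on `n` working qubits and `k` ancilla qubits, with answers
in `O`, as finite trees. A node either stops with an answer, or performs a round: it prepares a
state of all `n + k` qubits, queries the unknown channel once for each entry of the list of
data-processing channels, applying that entry right after the query, and measures a POVM on all
`n + k` qubits; the rest of the protocol depends on the outcome, hence (inductively) on the whole
history of outcomes. The last entry of a list may be the identity, so the round may also end in a
query; a round with the empty list makes no query and is a source of classical randomness. -/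
inductive Protocol (n k : ℕ) (O : Type) : Type
  | output (o : O) : Protocol n k O
  | round (ρ : DensityMatrix (Sys n k)) (channels : List (QuantumChannel (Sys n k))) (r : ℕ)
      (M : POVM (Sys n k) r) (next : Fin r → Protocol n k O) : Protocol n k O

/-- The state before the measurement of a round: `C_m (Λ ⊗ id (⋯ C₁ (Λ ⊗ id (ρ))))`. -/
def evolve {n k : ℕ} (Λ : Matrix (Qubits n) (Qubits n) ℂ →ₗ[ℂ] Matrix (Qubits n) (Qubits n) ℂ)
    (ρ : DensityMatrix (Sys n k)) (channels : List (QuantumChannel (Sys n k))) :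
    Matrix (Sys n k) (Sys n k) ℂ :=
  channels.foldl (fun σ C => C.map (ampliate (Qubits k) Λ σ)) ρ.mat

namespace Protocol

variable {n k : ℕ} {O : Type}

/-- The probability that the answer of the protocol lies in `S` when the unknown channel is `Λ`;
outcome `j` of a round has probability `Tr (E_j ρ_out)`. -/
def prob (Λ : Matrix (Qubits n) (Qubits n) ℂ →ₗ[ℂ] Matrix (Qubits n) (Qubits n) ℂ) (S : Set O) :
    Protocol n k O → ℝ
  | output o => S.indicator 1 o
  | round ρ channels _ M next =>
      ∑ j, (M.effect j * evolve Λ ρ channels).trace.re * prob Λ S (next j)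

/-- The query complexity: the largest total number of queries to the unknown channel along a
branch of the protocol. -/
def queries : Protocol n k O → ℕ
  | output _ => 0
  | round _ channels _ _ next => channels.length + Finset.univ.sup fun j => queries (next j)

end Protocol

/-- The protocol solves Pauli eigenvalue estimation to error `ε` with probability at least `δ`:
for every Pauli channel, with that probability all its estimates are off by less than `ε`. -/
def SolvesEigenvalueEstimation {n k : ℕ} (𝒜 : Protocol n k (PauliIndex n → ℝ)) (ε δ : ℝ) : Prop :=
  ∀ p ∈ stdSimplex ℝ (PauliIndex n),
    δ ≤ 𝒜.prob (pauliChannel p) {est | ∀ b, |est b - pauliEigenvalue p b| < ε}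

/-- The protocol solves Pauli spike detection with probability at least `δ`: the unknown channel is
with equal probability either depolarizing (correct answer `false`) or spiked at a uniformly
random `a ≠ 0` (correct answer `true`). -/
def SolvesSpikeDetection {n k : ℕ} (𝒜 : Protocol n k Bool) (δ : ℝ) : Prop :=
  δ ≤ 1 / 2 * 𝒜.prob (depolarizing n) {false} +
    1 / 2 * ((∑ a : {a : PauliIndex n // a ≠ 0}, 𝒜.prob (spiked a.1) {true}) / (4 ^ n - 1))

end PauliLearning

end

open PauliLearning

noncomputable section

namespace PauliLearning

open scoped Matrix ComplexOrder

/-! ### Pauli operators -/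

/-! A single query barely separates a typical spiked channel from the depolarizing one. On a state
`σ` and a fixed pair of ancilla indices, with `X` the corresponding block of `σ`, the two outputs
differ by `2⁻ⁿ c Tr(P_a X) P_a`. Since the Pauli operators are orthogonal, Bessel's inequality
bounds the squared Hilbert–Schmidt norms of these differences, summed over all `a ≠ 0`, by `Tr σ² ≤
1` (`sum_norm_sq_ampliate_spike_sub_le`). Cauchy–Schwarz over the `2^(n+k)` eigenvalues and again
over the fewer than `4^n` spikes bounds the total trace-norm deviation by `K = √(4^n 2^(n+k))`
(`totalDeviationLE_spikes`).

A hybrid argument makes the deviation additive over queries and rounds, adaptivity included: `q`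
queries change the answer probabilities by at most `qK` in total over `a`
(`Protocol.sum_abs_prob_sub_le`). Either task forces a total change of order `4^n`. Hence `q` is at
least of order `2^((n-k)/2)`, which is weakened to exponent `(n-k)/3` at the end; for `k ≥ n` the
bound `q ≥ 1` suffices. -/

lemma neg_one_pow_val_add {R : Type*} [Ring R] (x y : ZMod 2) :
    (-1 : R) ^ (x + y).val = (-1) ^ x.val * (-1) ^ y.val := by
  rw [ZMod.val_add, ← pow_add, neg_one_pow_eq_pow_mod_two (n := x.val + y.val)]

lemma neg_one_pow_val_sum {R : Type*} [CommRing R] {ι : Type*} (s : Finset ι) (f : ι → ZMod 2) :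
    (-1 : R) ^ (∑ i ∈ s, f i).val = ∏ i ∈ s, (-1) ^ (f i).val := by
  classical
  induction s using Finset.induction_on with
  | empty => simp
  | insert i s hi ih => rw [Finset.sum_insert hi, Finset.prod_insert hi, neg_one_pow_val_add, ih]

lemma symplectic_comm {n : ℕ} (a b : PauliIndex n) : symplectic a b = symplectic b a :=
  Finset.sum_congr rfl fun i _ => by ring

lemma neg_one_pow_symplectic {R : Type*} [CommRing R] {n : ℕ} (a b : PauliIndex n) :
    (-1 : R) ^ (symplectic a b).val =
      ∏ i, (-1) ^ ((a i).1 * (b i).2 + (a i).2 * (b i).1).val :=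
  neg_one_pow_val_sum _ _

lemma sum_zmod_two_prod {M : Type*} [AddCommMonoid M] (f : ZMod 2 × ZMod 2 → M) :
    ∑ b, f b = f (0, 0) + f (0, 1) + (f (1, 0) + f (1, 1)) := by
  rw [Fintype.sum_prod_type]
  change ∑ x : Fin 2, ∑ y : Fin 2, f (x, y) = _
  simp only [Fin.sum_univ_two]
  rfl

lemma zmod_two_prod_cases (a : ZMod 2 × ZMod 2) :
    a = (0, 0) ∨ a = (0, 1) ∨ a = (1, 0) ∨ a = (1, 1) := by
  revert a; decide

lemma val_one_zmod_two : (1 : ZMod 2).val = 1 := rfl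

lemma val_two_zmod_two : (2 : ZMod 2).val = 0 := rfl

lemma pauli₁_twirl (a : ZMod 2 × ZMod 2) (s i j t : Fin 2) :
    ∑ b, (-1 : ℂ) ^ (a.1 * b.2 + a.2 * b.1).val * (pauli₁ b s i * pauli₁ b j t) =
      2 * (pauli₁ a j i * pauli₁ a s t) := by
  rw [sum_zmod_two_prod]
  rcases zmod_two_prod_cases a with rfl | rfl | rfl | rfl <;> fin_cases s <;> fin_cases i <;>
    fin_cases j <;> fin_cases t <;>
    norm_num [pauli₁, val_one_zmod_two, val_two_zmod_two, Matrix.mul_apply, Fin.sum_univ_two]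

lemma star_pauli₁ (a : ZMod 2 × ZMod 2) (i j : Fin 2) : star (pauli₁ a i j) = pauli₁ a j i := by
  rcases zmod_two_prod_cases a with rfl | rfl | rfl | rfl <;> fin_cases i <;> fin_cases j <;>
    norm_num [pauli₁, val_one_zmod_two, Matrix.mul_apply, Fin.sum_univ_two]

lemma pauli₁_mul_self (a : ZMod 2 × ZMod 2) (i k : Fin 2) :
    ∑ j, pauli₁ a i j * pauli₁ a j k = if i = k then 1 else 0 := by
  rcases zmod_two_prod_cases a with rfl | rfl | rfl | rfl <;> fin_cases i <;> fin_cases k <;>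
    norm_num [pauli₁, val_one_zmod_two, Matrix.mul_apply, Fin.sum_univ_two]

lemma pauli₁_orthogonal (a b : ZMod 2 × ZMod 2) :
    ∑ s, ∑ t, pauli₁ a s t * pauli₁ b t s = if a = b then 2 else 0 := by
  rcases zmod_two_prod_cases a with rfl | rfl | rfl | rfl <;>
    rcases zmod_two_prod_cases b with rfl | rfl | rfl | rfl <;>
    norm_num [pauli₁, val_one_zmod_two, Matrix.mul_apply, Fin.sum_univ_two]

lemma sum_neg_one_pow_eq_zero {a : ZMod 2 × ZMod 2} (ha : a ≠ 0) :
    ∑ b : ZMod 2 × ZMod 2, (-1 : ℝ) ^ (a.1 * b.2 + a.2 * b.1).val = 0 := by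
  rw [sum_zmod_two_prod]
  rcases zmod_two_prod_cases a with rfl | rfl | rfl | rfl
  · exact absurd rfl ha
  all_goals norm_num [val_one_zmod_two, val_two_zmod_two]

section
variable {n : ℕ}

/-- For the matrix unit `E_ij` this is the `(s, t)` entry of `∑_b (-1)^⟨a,b⟩ P_b E_ij P_b = 2ⁿ
Tr(P_a E_ij) P_a`. Both sides factor over the qubits, which leaves the finite check `pauli₁_twirl`.
-/
lemma pauli_twirl (a : PauliIndex n) (s i j t : Qubits n) :
    ∑ b, (-1 : ℂ) ^ (symplectic a b).val * (pauli b s i * pauli b j t) =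
      2 ^ n * (pauli a j i * pauli a s t) := by
  simp only [neg_one_pow_symplectic, pauli, Matrix.of_apply, ← Finset.prod_mul_distrib]
  rw [← Fintype.prod_sum fun l (b : ZMod 2 × ZMod 2) =>
    (-1 : ℂ) ^ ((a l).1 * b.2 + (a l).2 * b.1).val *
      (pauli₁ b (s l) (i l) * pauli₁ b (j l) (t l))]
  simp [pauli₁_twirl, Finset.prod_mul_distrib]

lemma star_pauli_apply (a : PauliIndex n) (i j : Qubits n) :
    star (pauli a i j) = pauli a j i := by
  simp only [pauli, Matrix.of_apply, star_prod, star_pauli₁]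

lemma pauli_isHermitian (a : PauliIndex n) : (pauli a).IsHermitian := by
  ext i j; exact star_pauli_apply a j i

lemma pauli_mul_self (a : PauliIndex n) : pauli a * pauli a = 1 := by
  ext i k
  simp only [Matrix.mul_apply, pauli, Matrix.of_apply, ← Finset.prod_mul_distrib]
  rw [← Fintype.prod_sum fun l (j : Fin 2) => pauli₁ (a l) (i l) j * pauli₁ (a l) j (k l)]
  simp only [pauli₁_mul_self, Matrix.one_apply, funext_iff]
  rw [Finset.prod_ite_zero]; simp

lemma pauli_orthogonal (a b : PauliIndex n) :
    ∑ s, ∑ t, pauli a s t * pauli b t s = if a = b then 2 ^ n else 0 := by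
  simp only [pauli, Matrix.of_apply, ← Finset.prod_mul_distrib]
  rw [Finset.sum_congr rfl fun (s : Qubits n) _ => (Fintype.prod_sum fun l (t : Fin 2) =>
    pauli₁ (a l) (s l) t * pauli₁ (b l) t (s l)).symm]
  rw [← Fintype.prod_sum fun l (s : Fin 2) => ∑ t, pauli₁ (a l) s t * pauli₁ (b l) t s]
  simp only [pauli₁_orthogonal, funext_iff]
  rw [Finset.prod_ite_zero]; simp

lemma pauli₁_zero : pauli₁ 0 = 1 := by
  simp [pauli₁]

lemma pauli_zero : pauli (0 : PauliIndex n) = 1 := by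
  ext i j
  simp only [pauli, Matrix.of_apply, Pi.zero_apply, pauli₁_zero, Matrix.one_apply, funext_iff]
  rw [Finset.prod_ite_zero]; simp

/-- A nontrivial character sums to zero: a qubit where `a` is nonzero contributes a vanishing
factor. -/
lemma sum_neg_one_pow_symplectic {a : PauliIndex n} (ha : a ≠ 0) :
    ∑ b, (-1 : ℝ) ^ (symplectic a b).val = 0 := by
  simp only [neg_one_pow_symplectic]
  rw [← Fintype.prod_sum fun l (b : ZMod 2 × ZMod 2) =>
    (-1 : ℝ) ^ ((a l).1 * b.2 + (a l).2 * b.1).val]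
  obtain ⟨l, hl⟩ := Function.ne_iff.1 ha
  exact Finset.prod_eq_zero (Finset.mem_univ l) (sum_neg_one_pow_eq_zero hl)

lemma card_pauliIndex : Fintype.card (PauliIndex n) = 4 ^ n := by
  simp

end

/-! ### Trace-norm bounds -/

section
variable {I : Type} [Fintype I]

/-- A Hermitian matrix of trace norm at most `τ`, by way of a decomposition into positive parts. -/
def TraceBound (X : Matrix I I ℂ) (τ : ℝ) : Prop :=
  ∃ P Q : Matrix I I ℂ, P.PosSemidef ∧ Q.PosSemidef ∧ X = P - Q ∧ P.trace.re + Q.trace.re ≤ τ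

/-- Positive trace-preserving maps. -/
structure IsPositiveTP (Φ : Matrix I I ℂ →ₗ[ℂ] Matrix I I ℂ) : Prop where
  posSemidef : ∀ X, X.PosSemidef → (Φ X).PosSemidef
  trace : ∀ X, (Φ X).trace = X.trace

/-- Trace-norm contraction: the map sends the two positive parts to positive matrices with the same
traces. -/
lemma TraceBound.map {X : Matrix I I ℂ} {τ : ℝ} (h : TraceBound X τ)
    {Φ : Matrix I I ℂ →ₗ[ℂ] Matrix I I ℂ} (hΦ : IsPositiveTP Φ) : TraceBound (Φ X) τ := by
  obtain ⟨P, Q, hP, hQ, rfl, h⟩ := h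
  exact ⟨Φ P, Φ Q, hΦ.posSemidef _ hP, hΦ.posSemidef _ hQ, map_sub _ _ _, by
    rwa [hΦ.trace, hΦ.trace]⟩

lemma TraceBound.add {X Y : Matrix I I ℂ} {σ τ : ℝ} (h : TraceBound X σ) (h' : TraceBound Y τ) :
    TraceBound (X + Y) (σ + τ) := by
  obtain ⟨P, Q, hP, hQ, rfl, h⟩ := h
  obtain ⟨P', Q', hP', hQ', rfl, h'⟩ := h'
  exact ⟨P + P', Q + Q', hP.add hP', hQ.add hQ', by abel, by
    simp only [Matrix.trace_add, Complex.add_re]; linarith⟩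

lemma traceBound_zero : TraceBound (0 : Matrix I I ℂ) 0 :=
  ⟨0, 0, .zero, .zero, by simp, by simp⟩

lemma trace_mul_re_nonneg {E P : Matrix I I ℂ} (hE : E.PosSemidef) (hP : P.PosSemidef) :
    0 ≤ (E * P).trace.re := by
  classical
  open scoped MatrixOrder in
  obtain ⟨B, rfl⟩ := CStarAlgebra.nonneg_iff_eq_star_mul_self.1 hE.nonneg
  rw [Matrix.star_eq_conjTranspose]
  rw [Matrix.mul_assoc, Matrix.trace_mul_comm]
  exact (Complex.le_def.1 (hP.mul_mul_conjTranspose_same B).trace_nonneg).1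

/-- For `0 ≤ F ≤ 1` the value lies between `-Tr Q` and `Tr P`. -/
lemma TraceBound.abs_trace_mul_le [DecidableEq I] {X F : Matrix I I ℂ} {τ : ℝ}
    (h : TraceBound X τ) (hF : F.PosSemidef) (hF' : (1 - F).PosSemidef) :
    |(F * X).trace.re| ≤ τ := by
  obtain ⟨P, Q, hP, hQ, rfl, h⟩ := h
  have h1 := trace_mul_re_nonneg hF hP
  have h2 := trace_mul_re_nonneg hF hQ
  have h3 := trace_mul_re_nonneg hF' hP
  have h4 := trace_mul_re_nonneg hF' hQ
  simp only [Matrix.sub_mul, Matrix.mul_sub, one_mul, Matrix.trace_sub, Complex.sub_re] at *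
  rw [abs_le]; constructor <;> linarith

/-- Both sides equal `Tr X²`. -/
lemma sum_eigenvalues_sq [DecidableEq I] {X : Matrix I I ℂ} (hX : X.IsHermitian) :
    ∑ i, hX.eigenvalues i ^ 2 = ∑ i, ∑ j, ‖X i j‖ ^ 2 := by
  have h1 : (X * X).trace = ∑ i, ((hX.eigenvalues i : ℂ)) ^ 2 := by
    conv_lhs => rw [hX.spectral_theorem, ← map_mul, Unitary.conjStarAlgAut_apply,
      Matrix.trace_mul_comm, ← mul_assoc]
    simp [Matrix.diagonal_mul_diagonal, Matrix.trace_diagonal, sq]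
  have h2 : (X * X).trace = ∑ i, ∑ j, ((‖X i j‖ : ℂ)) ^ 2 := by
    simp only [Matrix.trace, Matrix.diag, Matrix.mul_apply]
    refine Finset.sum_congr rfl fun i _ => Finset.sum_congr rfl fun j _ => ?_
    rw [← Complex.mul_conj', ← hX.apply j i, ← starRingEnd_apply]
  exact_mod_cast h1.symm.trans h2

/-- Splitting the spectrum by sign gives the sum of the `|λ_i|`; Cauchy–Schwarz compares it with the
Hilbert–Schmidt norm, at the cost of the square root of the dimension. -/
lemma traceBound_of_isHermitian {X : Matrix I I ℂ} (hX : X.IsHermitian) :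
    TraceBound X √(Fintype.card I * ∑ i, ∑ j, ‖X i j‖ ^ 2) := by
  classical
  have hpos (f : I → ℝ) (hf : ∀ i, 0 ≤ f i) : (Unitary.conjStarAlgAut ℂ _ hX.eigenvectorUnitary
      (Matrix.diagonal fun i => (f i : ℂ))).PosSemidef := by
    rw [Unitary.conjStarAlgAut_apply]
    exact (Matrix.posSemidef_diagonal_iff.2 fun i => by
      exact_mod_cast hf i).mul_mul_conjTranspose_same _
  have htr (f : I → ℝ) : (Unitary.conjStarAlgAut ℂ _ hX.eigenvectorUnitary
      (Matrix.diagonal fun i => (f i : ℂ))).trace.re = ∑ i, f i := by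
    rw [Unitary.conjStarAlgAut_apply, Matrix.trace_mul_comm, ← mul_assoc]
    simp [Matrix.trace_diagonal]
  refine ⟨_, _, hpos (fun i => (hX.eigenvalues i)⁺) fun i => posPart_nonneg _,
    hpos (fun i => (hX.eigenvalues i)⁻) fun i => negPart_nonneg _, ?_, ?_⟩
  · conv_lhs => rw [hX.spectral_theorem]
    rw [← map_sub, Matrix.diagonal_sub]
    congr 3
    ext i
    simp [← Complex.ofReal_sub, posPart_sub_negPart]
  · rw [htr, htr, ← Finset.sum_add_distrib]
    simp only [posPart_add_negPart]
    apply Real.le_sqrt_of_sq_le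
    rw [← sum_eigenvalues_sq hX]
    have := sq_sum_le_card_mul_sum_sq (s := Finset.univ) (f := fun i => |hX.eigenvalues i|)
    simpa using this

lemma sum_norm_sq_le_one {X : Matrix I I ℂ} (hX : X.PosSemidef) (h : X.trace = 1) :
    ∑ i, ∑ j, ‖X i j‖ ^ 2 ≤ 1 := by
  classical
  rw [← sum_eigenvalues_sq hX.isHermitian]
  have h1 : ∑ i, hX.isHermitian.eigenvalues i = 1 := by
    have := hX.isHermitian.trace_eq_sum_eigenvalues
    rw [h] at this
    simpa using (congrArg Complex.re this).symm
  calc _ ≤ (∑ i, hX.isHermitian.eigenvalues i) ^ 2 :=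
        Finset.sum_sq_le_sq_sum_of_nonneg fun i _ => hX.eigenvalues_nonneg i
    _ = 1 := by rw [h1, one_pow]

end

/-! ### Hybrid argument -/

lemma QuantumChannel.isPositiveTP {I : Type} [Fintype I] (C : QuantumChannel I) :
    IsPositiveTP C.map where
  posSemidef X hX := by
    have h := (C.completelyPositive 1 (X.submatrix Prod.fst Prod.fst) (hX.submatrix _)).submatrix
      fun i : I => (i, (0 : Fin 1))
    exact h
  trace := C.tracePreserving

section
variable {n k : ℕ} {Λ Λ₀ : Matrix (Qubits n) (Qubits n) ℂ →ₗ[ℂ] Matrix (Qubits n) (Qubits n) ℂ}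

lemma evolve_posSemidef (hΛ : IsPositiveTP (ampliate (Qubits k) Λ)) (ρ : DensityMatrix (Sys n k))
    (cs : List (QuantumChannel (Sys n k))) : (evolve Λ ρ cs).PosSemidef := by
  rw [evolve]
  induction cs using List.reverseRecOn with
  | nil => exact ρ.posSemidef
  | append_singleton cs C ih =>
    rw [List.foldl_append]
    exact C.isPositiveTP.posSemidef _ (hΛ.posSemidef _ ih)

lemma trace_evolve (hΛ : IsPositiveTP (ampliate (Qubits k) Λ)) (ρ : DensityMatrix (Sys n k))
    (cs : List (QuantumChannel (Sys n k))) : (evolve Λ ρ cs).trace = 1 := by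
  rw [evolve]
  induction cs using List.reverseRecOn with
  | nil => exact ρ.trace_eq_one
  | append_singleton cs C ih =>
    rw [List.foldl_append]
    exact (C.isPositiveTP.trace _).trans ((hΛ.trace _).trans ih)

lemma POVM.sum_trace {I : Type} [Fintype I] [DecidableEq I] {r : ℕ} (M : POVM I r)
    (X : Matrix I I ℂ) : ∑ j, (M.effect j * X).trace.re = X.trace.re := by
  rw [← Complex.re_sum, ← Matrix.trace_sum, ← Matrix.sum_mul, M.sum_eq_one, one_mul]

variable {O : Type}

lemma Protocol.prob_nonneg (hΛ : IsPositiveTP (ampliate (Qubits k) Λ)) (S : Set O)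
    (𝒜 : Protocol n k O) : 0 ≤ 𝒜.prob Λ S := by
  induction 𝒜 with
  | output o => exact Set.indicator_nonneg (fun _ _ => zero_le_one) _
  | round ρ cs r M next ih =>
    exact Finset.sum_nonneg fun j _ => mul_nonneg
      (trace_mul_re_nonneg (M.posSemidef j) (evolve_posSemidef hΛ ρ cs)) (ih j)

lemma Protocol.prob_mono (hΛ : IsPositiveTP (ampliate (Qubits k) Λ)) {S T : Set O} (h : S ⊆ T)
    (𝒜 : Protocol n k O) : 𝒜.prob Λ S ≤ 𝒜.prob Λ T := by
  induction 𝒜 with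
  | output o =>
    exact Set.indicator_le_indicator_of_subset h (fun _ => zero_le_one) o
  | round ρ cs r M next ih =>
    exact Finset.sum_le_sum fun j _ => mul_le_mul_of_nonneg_left (ih j)
      (trace_mul_re_nonneg (M.posSemidef j) (evolve_posSemidef hΛ ρ cs))

lemma Protocol.prob_add_prob_compl (hΛ : IsPositiveTP (ampliate (Qubits k) Λ)) (S : Set O)
    (𝒜 : Protocol n k O) : 𝒜.prob Λ S + 𝒜.prob Λ Sᶜ = 1 := by
  induction 𝒜 with
  | output o =>
    by_cases h : o ∈ S <;> simp [prob, h]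
  | round ρ cs r M next ih =>
    simp only [prob, ← Finset.sum_add_distrib, ← mul_add, ih, mul_one]
    rw [M.sum_trace, trace_evolve hΛ, Complex.one_re]

lemma Protocol.prob_le_one (hΛ : IsPositiveTP (ampliate (Qubits k) Λ)) (S : Set O)
    (𝒜 : Protocol n k O) : 𝒜.prob Λ S ≤ 1 := by
  linarith [𝒜.prob_add_prob_compl hΛ S, 𝒜.prob_nonneg hΛ Sᶜ]

variable {ι : Type} [Fintype ι]
  {Φ : ι → Matrix (Qubits n) (Qubits n) ℂ →ₗ[ℂ] Matrix (Qubits n) (Qubits n) ℂ} {K : ℝ}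

/-- In total over `a`, a single use of `Φ a` differs from one of `Λ₀` by at most `K` in trace norm,
on every state with `k` ancilla qubits. -/
def TotalDeviationLE (k : ℕ)
    (Φ : ι → Matrix (Qubits n) (Qubits n) ℂ →ₗ[ℂ] Matrix (Qubits n) (Qubits n) ℂ)
    (Λ₀ : Matrix (Qubits n) (Qubits n) ℂ →ₗ[ℂ] Matrix (Qubits n) (Qubits n) ℂ) (K : ℝ) : Prop :=
  ∀ σ : Matrix (Sys n k) (Sys n k) ℂ, σ.PosSemidef → σ.trace = 1 → ∃ τ : ι → ℝ,
    (∀ a, TraceBound (ampliate (Qubits k) (Φ a) σ - ampliate (Qubits k) Λ₀ σ) (τ a)) ∧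
      ∑ a, τ a ≤ K

/-- Telescoping via `Φ_a ρ_a - Λ₀ ρ₀ = Φ_a (ρ_a - ρ₀) + (Φ_a - Λ₀) ρ₀`: the first term contracts,
and each query adds one second term. -/
lemma exists_traceBound_evolve_sub (hΦ : ∀ a, IsPositiveTP (ampliate (Qubits k) (Φ a)))
    (h₀ : IsPositiveTP (ampliate (Qubits k) Λ₀)) (hK : TotalDeviationLE k Φ Λ₀ K)
    (ρ : DensityMatrix (Sys n k)) (cs : List (QuantumChannel (Sys n k))) :
    ∃ τ : ι → ℝ, (∀ a, TraceBound (evolve (Φ a) ρ cs - evolve Λ₀ ρ cs) (τ a)) ∧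
      ∑ a, τ a ≤ cs.length * K := by
  induction cs using List.reverseRecOn with
  | nil => exact ⟨0, fun a => by simpa [evolve] using traceBound_zero, by simp⟩
  | append_singleton cs C ih =>
    obtain ⟨τ, hτ, hτK⟩ := ih
    -- The reference trajectory under `Λ₀` does not depend on `a`, so one application of `hK` covers
    -- all `a` at once.
    obtain ⟨σ, hσ, hσK⟩ := hK _ (evolve_posSemidef h₀ ρ cs) (trace_evolve h₀ ρ cs)
    refine ⟨fun a => τ a + σ a, fun a => ?_, ?_⟩
    · have := (((hτ a).map (hΦ a)).add (hσ a)).map C.isPositiveTP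
      simp only [map_sub, sub_add_sub_cancel] at this
      simpa [evolve] using this
    · rw [Finset.sum_add_distrib, List.length_append, List.length_singleton]
      push_cast
      linarith

lemma POVM.weighted {I : Type} [Fintype I] [DecidableEq I] {r : ℕ} (M : POVM I r)
    {v : Fin r → ℝ} (hv : ∀ j, 0 ≤ v j) : (∑ j, (v j : ℂ) • M.effect j).PosSemidef :=
  Matrix.posSemidef_sum _ fun j _ => (M.posSemidef j).smul (by exact_mod_cast hv j)

/-- With `v j` the probability of a given event after outcome `j`, the measurement and the rest of
the protocol merge into the single effect `∑ v_j E_j`. The bound is therefore independent of the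
number of outcomes. -/
lemma POVM.abs_sum_trace_le {I : Type} [Fintype I] [DecidableEq I] {r : ℕ} (M : POVM I r)
    {v : Fin r → ℝ} (hv : ∀ j, 0 ≤ v j) (hv' : ∀ j, v j ≤ 1) {X : Matrix I I ℂ} {τ : ℝ}
    (hX : TraceBound X τ) : |∑ j, (M.effect j * X).trace.re * v j| ≤ τ := by
  have h := hX.abs_trace_mul_le (M.weighted hv) (by
    have := M.weighted (v := fun j => 1 - v j) fun j => sub_nonneg.2 (hv' j)
    simpa [sub_smul, M.sum_eq_one] using this)
  convert h using 2
  simp [Matrix.sum_mul, Matrix.trace_sum, mul_comm]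

lemma Protocol.sum_abs_prob_sub_le (hΦ : ∀ a, IsPositiveTP (ampliate (Qubits k) (Φ a)))
    (h₀ : IsPositiveTP (ampliate (Qubits k) Λ₀)) (hK : TotalDeviationLE k Φ Λ₀ K) (hK0 : 0 ≤ K)
    (S : ι → Set O) (𝒜 : Protocol n k O) :
    ∑ a, |𝒜.prob (Φ a) (S a) - 𝒜.prob Λ₀ (S a)| ≤ 𝒜.queries * K := by
  induction 𝒜 with
  | output o => simp [prob, queries]
  | round ρ cs r M next ih =>
    obtain ⟨τ, hτ, hτK⟩ := exists_traceBound_evolve_sub hΦ h₀ hK ρ cs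
    have hp (j : Fin r) : 0 ≤ (M.effect j * evolve Λ₀ ρ cs).trace.re :=
      trace_mul_re_nonneg (M.posSemidef j) (evolve_posSemidef h₀ ρ cs)
    have hstep (a : ι) : |(round ρ cs r M next).prob (Φ a) (S a) -
        (round ρ cs r M next).prob Λ₀ (S a)| ≤ τ a +
          ∑ j, (M.effect j * evolve Λ₀ ρ cs).trace.re *
            |(next j).prob (Φ a) (S a) - (next j).prob Λ₀ (S a)| := by
      -- The intermediate hybrid runs this round with `Λ₀` and the later ones with `Φ a`. In the
      -- second sum the outcome weights are free of `a`, so the sum over `a` can be taken inside,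
      -- where the induction hypothesis applies.
      have heq : (round ρ cs r M next).prob (Φ a) (S a) - (round ρ cs r M next).prob Λ₀ (S a) =
          (∑ j, (M.effect j * (evolve (Φ a) ρ cs - evolve Λ₀ ρ cs)).trace.re *
            (next j).prob (Φ a) (S a)) + ∑ j, (M.effect j * evolve Λ₀ ρ cs).trace.re *
              ((next j).prob (Φ a) (S a) - (next j).prob Λ₀ (S a)) := by
        simp only [prob, ← Finset.sum_sub_distrib, ← Finset.sum_add_distrib]
        refine Finset.sum_congr rfl fun j _ => ?_
        rw [Matrix.mul_sub, Matrix.trace_sub, Complex.sub_re]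
        ring
      rw [heq]
      refine (abs_add_le _ _).trans (add_le_add (M.abs_sum_trace_le
        (fun j => (next j).prob_nonneg (hΦ a) _) (fun j => (next j).prob_le_one (hΦ a) _) (hτ a))
        ((Finset.abs_sum_le_sum_abs _ _).trans_eq (Finset.sum_congr rfl fun j _ => ?_)))
      rw [abs_mul, abs_of_nonneg (hp j)]
    refine (Finset.sum_le_sum fun a _ => hstep a).trans ?_
    rw [Finset.sum_add_distrib, Finset.sum_comm]
    simp only [← Finset.mul_sum, queries]
    have hnext (j : Fin r) : ∑ a, |(next j).prob (Φ a) (S a) - (next j).prob Λ₀ (S a)| ≤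
        (Finset.univ.sup fun j => (next j).queries : ℕ) * K :=
      (ih j).trans (mul_le_mul_of_nonneg_right (by
        exact_mod_cast Finset.le_sup (f := fun j => (next j).queries) (Finset.mem_univ j)) hK0)
    have := Finset.sum_le_sum fun j (_ : j ∈ Finset.univ) =>
      mul_le_mul_of_nonneg_left (hnext j) (hp j)
    rw [← Finset.sum_mul, M.sum_trace, trace_evolve h₀, Complex.one_re, one_mul] at this
    push_cast
    linarith

end

/-! ### Pauli channels -/

section
variable {n k : ℕ}

open scoped Kronecker

lemma pauliChannel_apply (p : PauliIndex n → ℝ) (X : Matrix (Qubits n) (Qubits n) ℂ) :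
    pauliChannel p X = ∑ a, (p a : ℂ) • (pauli a * X * pauli a) := by
  simp [pauliChannel, LinearMap.sum_apply]

lemma ampliate_pauliChannel_apply (p : PauliIndex n → ℝ) (X : Matrix (Sys n k) (Sys n k) ℂ) :
    ampliate (Qubits k) (pauliChannel p) X = ∑ a, (p a : ℂ) •
      ((pauli a ⊗ₖ (1 : Matrix (Qubits k) (Qubits k) ℂ)) * X *
        (pauli a ⊗ₖ (1 : Matrix (Qubits k) (Qubits k) ℂ))) := by
  ext ⟨s, u⟩ ⟨t, v⟩
  simp [ampliate, pauliChannel_apply, Matrix.sum_apply, Matrix.mul_apply, Fintype.sum_prod_type,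
    Matrix.one_apply]

lemma isPositiveTP_pauliChannel {p : PauliIndex n → ℝ} (hp : p ∈ stdSimplex ℝ (PauliIndex n)) :
    IsPositiveTP (ampliate (Qubits k) (pauliChannel p)) where
  posSemidef X hX := by
    rw [ampliate_pauliChannel_apply]
    refine Matrix.posSemidef_sum _ fun a _ => Matrix.PosSemidef.smul ?_ (by exact_mod_cast hp.1 a)
    have h := hX.mul_mul_conjTranspose_same (pauli a ⊗ₖ (1 : Matrix (Qubits k) (Qubits k) ℂ))
    rwa [Matrix.conjTranspose_kronecker, (pauli_isHermitian a).eq, Matrix.conjTranspose_one] at h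
  trace X := by
    have h (a : PauliIndex n) : ((pauli a ⊗ₖ (1 : Matrix (Qubits k) (Qubits k) ℂ)) * X *
        (pauli a ⊗ₖ (1 : Matrix (Qubits k) (Qubits k) ℂ))).trace = X.trace := by
      rw [Matrix.trace_mul_comm, ← mul_assoc, ← Matrix.mul_kronecker_mul, pauli_mul_self]
      simp
    rw [ampliate_pauliChannel_apply, Matrix.trace_sum]
    simp only [Matrix.trace_smul, h, ← Finset.sum_smul]
    rw [← Complex.ofReal_sum, hp.2, Complex.ofReal_one, one_smul]

/-- The error rates of the Pauli channel whose nonzero Pauli eigenvalues are `1` at `0` and `c` at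
`a`. -/
def spikeRates (a : PauliIndex n) (c : ℝ) (b : PauliIndex n) : ℝ :=
  (4 ^ n)⁻¹ * (1 + c * (-1) ^ (symplectic a b).val)

lemma spikeRates_mem {a : PauliIndex n} (ha : a ≠ 0) {c : ℝ} (hc : |c| ≤ 1) :
    spikeRates a c ∈ stdSimplex ℝ (PauliIndex n) := by
  refine ⟨fun b => mul_nonneg (by positivity) ?_, ?_⟩
  · have h : |c * (-1) ^ (symplectic a b).val| ≤ 1 := by simpa [abs_mul] using hc
    linarith [(abs_le.1 h).1]
  · simp only [spikeRates, ← Finset.mul_sum, Finset.sum_add_distrib, sum_neg_one_pow_symplectic ha]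
    rw [Finset.sum_const, Finset.card_univ, card_pauliIndex]
    simp

lemma pauliEigenvalue_spikeRates {a : PauliIndex n} (ha : a ≠ 0) (c : ℝ) :
    pauliEigenvalue (spikeRates a c) a = c := by
  have h (b : PauliIndex n) : spikeRates a c b * (-1) ^ (symplectic b a).val =
      (4 ^ n)⁻¹ * ((-1) ^ (symplectic a b).val + c) := by
    rw [spikeRates, symplectic_comm b a, mul_assoc, add_mul, one_mul, mul_assoc, ← mul_pow]
    simp
  simp only [pauliEigenvalue, h, ← Finset.mul_sum, Finset.sum_add_distrib,
    sum_neg_one_pow_symplectic ha]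
  rw [Finset.sum_const, Finset.card_univ, card_pauliIndex]
  simp

/-- The rates combine the trivial character with that of `a`, so `pauli_twirl` at `0` and at `a`
evaluates the sum; the prefactor is `4⁻ⁿ 2ⁿ = 2⁻ⁿ`. -/
lemma sum_spikeRates_mul (a : PauliIndex n) (c : ℝ) (s i j t : Qubits n) :
    ∑ b, (spikeRates a c b : ℂ) * (pauli b s i * pauli b j t) = ((2 : ℂ) ^ n)⁻¹ *
      ((1 : Matrix (Qubits n) (Qubits n) ℂ) j i * (1 : Matrix (Qubits n) (Qubits n) ℂ) s t +
        c * (pauli a j i * pauli a s t)) := by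
  have h0 := pauli_twirl 0 s i j t
  have ha := pauli_twirl a s i j t
  simp only [pauli_zero] at h0
  have hz (b : PauliIndex n) : symplectic 0 b = 0 := by simp [symplectic]
  simp only [hz, ZMod.val_zero, pow_zero, one_mul] at h0
  have hb (b : PauliIndex n) : (spikeRates a c b : ℂ) * (pauli b s i * pauli b j t) =
      ((4 : ℂ) ^ n)⁻¹ * (pauli b s i * pauli b j t +
        c * ((-1) ^ (symplectic a b).val * (pauli b s i * pauli b j t))) := by
    simp only [spikeRates]; push_cast; ring
  simp only [hb, ← Finset.mul_sum, Finset.sum_add_distrib, h0, ha]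
  have : (4 : ℂ) ^ n = 2 ^ n * 2 ^ n := by rw [← mul_pow]; norm_num
  rw [this]
  field_simp

lemma pauliChannel_spikeRates_apply (a : PauliIndex n) (c : ℝ)
    (X : Matrix (Qubits n) (Qubits n) ℂ) :
    pauliChannel (spikeRates a c) X = ((2 : ℂ) ^ n)⁻¹ •
      (X.trace • (1 : Matrix (Qubits n) (Qubits n) ℂ) +
        (c : ℂ) • (pauli a * X).trace • pauli a) := by
  ext s t
  have hl : pauliChannel (spikeRates a c) X s t = ∑ j, ∑ i, X i j *
      ∑ b, (spikeRates a c b : ℂ) * (pauli b s i * pauli b j t) := by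
    simp only [pauliChannel_apply, Matrix.sum_apply, Matrix.smul_apply, Matrix.mul_apply,
      smul_eq_mul, Finset.mul_sum, Finset.sum_mul]
    rw [Finset.sum_comm]
    refine Finset.sum_congr rfl fun j _ => ?_
    rw [Finset.sum_comm]
    exact Finset.sum_congr rfl fun i _ => Finset.sum_congr rfl fun b _ => by ring
  have hX : X.trace = ∑ j, ∑ i, X i j * (1 : Matrix (Qubits n) (Qubits n) ℂ) j i := by
    simp [Matrix.trace, Matrix.one_apply]
  rw [hl]
  simp only [sum_spikeRates_mul, Matrix.smul_apply, Matrix.add_apply, smul_eq_mul, hX]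
  simp only [Matrix.trace, Matrix.diag, Matrix.mul_apply, Finset.sum_mul, Finset.mul_sum,
    ← Finset.sum_add_distrib]
  exact Finset.sum_congr rfl fun j _ => Finset.sum_congr rfl fun i _ => by ring

/-- Spike strength `0` gives the same channel for every `a`: a common reference point for all
spikes. -/
lemma depolarizing_eq (a : PauliIndex n) : depolarizing n = pauliChannel (spikeRates a 0) := by
  ext1 X
  simp [pauliChannel_spikeRates_apply, depolarizing]

lemma spiked_eq (a : PauliIndex n) : spiked a = pauliChannel (spikeRates a 1) := by
  ext1 X
  simp [pauliChannel_spikeRates_apply, spiked]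

lemma ampliate_spike_sub_apply (a : PauliIndex n) (c : ℝ) (σ : Matrix (Sys n k) (Sys n k) ℂ)
    (s t : Qubits n) (u v : Qubits k) :
    (ampliate (Qubits k) (pauliChannel (spikeRates a c)) σ -
      ampliate (Qubits k) (depolarizing n) σ) (s, u) (t, v) = ((2 : ℂ) ^ n)⁻¹ *
        (c * ((pauli a * Matrix.of fun i j => σ (i, u) (j, v)).trace * pauli a s t)) := by
  simp [depolarizing_eq a, ampliate, pauliChannel_spikeRates_apply]
  ring

/-! ### Hilbert–Schmidt deviation of one query, summed over all spikes. -/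

lemma sum_norm_sq_pauli (a : PauliIndex n) : ∑ s, ∑ t, ‖pauli a s t‖ ^ 2 = 2 ^ n := by
  have h := pauli_orthogonal a a
  rw [if_pos rfl] at h
  have hst (s t : Qubits n) : pauli a s t * pauli a t s = (‖pauli a s t‖ : ℂ) ^ 2 := by
    rw [← star_pauli_apply a s t, Complex.star_def, Complex.mul_conj']
  simp only [hst] at h
  exact_mod_cast h

/-- Bessel's inequality for the Hilbert–Schmidt orthonormal family `P_a / √(2ⁿ)`. -/
lemma sum_norm_sq_trace_pauli_mul_le (X : Matrix (Qubits n) (Qubits n) ℂ) :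
    ∑ a, ‖(pauli a * X).trace‖ ^ 2 ≤ 2 ^ n * ∑ s, ∑ t, ‖X s t‖ ^ 2 := by
  have h2 : (0 : ℝ) < 2 ^ n := by positivity
  have hsq : ((√(2 ^ n) : ℝ) : ℂ) * (√(2 ^ n) : ℝ) = 2 ^ n := by
    rw [← Complex.ofReal_mul, Real.mul_self_sqrt h2.le]; simp
  let w : PauliIndex n → EuclideanSpace ℂ (Qubits n × Qubits n) := fun a =>
    WithLp.toLp 2 fun st => ((√(2 ^ n) : ℝ) : ℂ)⁻¹ * pauli a st.1 st.2
  have hw (a : PauliIndex n) (Y : Matrix (Qubits n) (Qubits n) ℂ) :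
      inner ℂ (w a) (WithLp.toLp 2 fun st => Y st.1 st.2) =
        ((√(2 ^ n) : ℝ) : ℂ)⁻¹ * (pauli a * Y).trace := by
    simp only [w, PiLp.inner_apply, RCLike.inner_apply, Fintype.sum_prod_type, map_mul, map_inv₀,
      Complex.conj_ofReal, Matrix.trace, Matrix.diag, Matrix.mul_apply, Finset.mul_sum]
    rw [Finset.sum_comm]
    refine Finset.sum_congr rfl fun t _ => Finset.sum_congr rfl fun s _ => ?_
    rw [← star_pauli_apply a s t, ← Complex.star_def]
    ring
  have horth : Orthonormal ℂ w := by
    rw [orthonormal_iff_ite]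
    intro a b
    have := hw a (((√(2 ^ n) : ℝ) : ℂ)⁻¹ • pauli b)
    refine this.trans ?_
    rw [Matrix.mul_smul, Matrix.trace_smul]
    have hab := pauli_orthogonal a b
    simp only [Matrix.trace, Matrix.diag, Matrix.mul_apply, hab, smul_eq_mul]
    split_ifs
    · rw [← hsq]
      have : ((√(2 ^ n) : ℝ) : ℂ) ≠ 0 := by
        simp
      field_simp
    · simp
  have hB := horth.sum_inner_products_le (s := Finset.univ)
    (x := WithLp.toLp 2 fun st => X st.1 st.2)
  simp only [hw, norm_mul, mul_pow, norm_inv, ← Finset.mul_sum, Complex.norm_real,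
    Real.norm_eq_abs, abs_of_nonneg (Real.sqrt_nonneg _), inv_pow, Real.sq_sqrt h2.le,
    EuclideanSpace.norm_sq_eq, Fintype.sum_prod_type] at hB
  rwa [inv_mul_le_iff₀ h2] at hB

lemma sum_sys_sys (f : Sys n k → Sys n k → ℝ) : ∑ x, ∑ y, f x y =
    ∑ u, ∑ v, ∑ s, ∑ t, f (s, u) (t, v) := by
  simp only [Fintype.sum_prod_type_right]
  refine Finset.sum_congr rfl fun u _ => ?_
  rw [Finset.sum_comm]

lemma sum_norm_sq_ampliate_spike_sub_le (c : {a : PauliIndex n // a ≠ 0} → ℝ)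
    (hc : ∀ a, |c a| ≤ 1) (σ : Matrix (Sys n k) (Sys n k) ℂ) :
    ∑ a, ∑ x, ∑ y, ‖(ampliate (Qubits k) (pauliChannel (spikeRates a.1 (c a))) σ -
      ampliate (Qubits k) (depolarizing n) σ) x y‖ ^ 2 ≤ ∑ x, ∑ y, ‖σ x y‖ ^ 2 := by
  simp only [sum_sys_sys, ampliate_spike_sub_apply]
  rw [Finset.sum_comm]
  refine Finset.sum_le_sum fun u _ => ?_
  rw [Finset.sum_comm]
  refine Finset.sum_le_sum fun v _ => ?_
  set X : Matrix (Qubits n) (Qubits n) ℂ := Matrix.of fun i j => σ (i, u) (j, v) with hX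
  have h2 : (0 : ℝ) < 2 ^ n := by positivity
  -- Here `‖P_a‖² = 2ⁿ` cancels one of the two factors `2⁻ⁿ`; the remaining one is exactly what
  -- Bessel's inequality absorbs.
  have hterm (a : {a : PauliIndex n // a ≠ 0}) :
      ∑ s, ∑ t, ‖((2 : ℂ) ^ n)⁻¹ * (c a * ((pauli a.1 * X).trace * pauli a.1 s t))‖ ^ 2 ≤
        (2 ^ n)⁻¹ * ‖(pauli a.1 * X).trace‖ ^ 2 := by
    have hc2 : c a ^ 2 ≤ 1 := (sq_le_one_iff_abs_le_one _).2 (hc a)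
    simp only [norm_mul, mul_pow, ← Finset.mul_sum, sum_norm_sq_pauli, norm_inv, norm_pow,
      Complex.norm_real, Real.norm_eq_abs, sq_abs, Complex.norm_ofNat]
    calc _ = c a ^ 2 * ((2 ^ n)⁻¹ * ‖(pauli a.1 * X).trace‖ ^ 2) := by field_simp
      _ ≤ 1 * ((2 ^ n)⁻¹ * ‖(pauli a.1 * X).trace‖ ^ 2) := by gcongr
      _ = _ := one_mul _
  refine (Finset.sum_le_sum fun a _ => hterm a).trans ?_
  rw [← Finset.mul_sum, inv_mul_le_iff₀ h2]
  refine le_trans ?_ (sum_norm_sq_trace_pauli_mul_le X)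
  rw [← Fintype.sum_subtype_add_sum_subtype (fun a : PauliIndex n => a ≠ 0)]
  exact le_add_of_nonneg_right (Finset.sum_nonneg fun a _ => sq_nonneg _)

end

/-! ### Query lower bounds -/

section
variable {n k : ℕ}

lemma card_ne_zero_pauliIndex :
    (Fintype.card {a : PauliIndex n // a ≠ 0} : ℝ) = 4 ^ n - 1 := by
  have h : Fintype.card {a : PauliIndex n // a ≠ 0} + 1 = 4 ^ n := by
    rw [Fintype.card_subtype_compl, Fintype.card_subtype_eq, card_pauliIndex]
    exact Nat.sub_add_cancel (Nat.one_le_pow _ _ (by norm_num))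
  rw [eq_sub_iff_add_eq]
  exact_mod_cast h

lemma isPositiveTP_depolarizing (hn : 1 ≤ n) :
    IsPositiveTP (ampliate (Qubits k) (depolarizing n)) := by
  have ha : (fun _ => (1, 0) : PauliIndex n) ≠ 0 := fun h => by
    simpa using congrFun h ⟨0, hn⟩
  rw [depolarizing_eq fun _ => (1, 0)]
  exact isPositiveTP_pauliChannel (spikeRates_mem ha (by simp))

lemma totalDeviationLE_spikes (c : {a : PauliIndex n // a ≠ 0} → ℝ) (hc : ∀ a, |c a| ≤ 1) :
    TotalDeviationLE k (fun a => pauliChannel (spikeRates a.1 (c a))) (depolarizing n)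
      √(4 ^ n * 2 ^ (n + k)) := by
  intro σ hσ hσ1
  let D (a : {a : PauliIndex n // a ≠ 0}) : Matrix (Sys n k) (Sys n k) ℂ :=
    ampliate (Qubits k) (pauliChannel (spikeRates a.1 (c a))) σ -
      ampliate (Qubits k) (depolarizing n) σ
  have hD (a) : (D a).IsHermitian :=
    ((isPositiveTP_pauliChannel (spikeRates_mem a.2 (hc a))).posSemidef σ hσ).isHermitian.sub (by
      rw [depolarizing_eq a.1]
      exact ((isPositiveTP_pauliChannel (spikeRates_mem a.2 (by simp))).posSemidef σ hσ).isHermitian)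
  refine ⟨fun a => √(Fintype.card (Sys n k) * ∑ i, ∑ j, ‖D a i j‖ ^ 2),
    fun a => traceBound_of_isHermitian (hD a), Real.le_sqrt_of_sq_le ?_⟩
  have hcard : (Fintype.card (Sys n k) : ℝ) = 2 ^ (n + k) := by simp [pow_add]
  -- Cauchy–Schwarz over the spikes supplies the factor `4^n`; the factor `2^(n+k)` is the dimension
  -- from `traceBound_of_isHermitian`.
  refine sq_sum_le_card_mul_sum_sq.trans ?_
  have hle : ∑ a, ∑ x, ∑ y, ‖D a x y‖ ^ 2 ≤ 1 :=
    (sum_norm_sq_ampliate_spike_sub_le c hc σ).trans (sum_norm_sq_le_one hσ hσ1)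
  have hsq (a) : √(Fintype.card (Sys n k) * ∑ i, ∑ j, ‖D a i j‖ ^ 2) ^ 2 =
      Fintype.card (Sys n k) * ∑ i, ∑ j, ‖D a i j‖ ^ 2 := Real.sq_sqrt (by positivity)
  rw [Finset.sum_congr rfl fun a _ => hsq a, ← Finset.mul_sum, hcard, Finset.card_univ,
    card_ne_zero_pauliIndex]
  have h4 : (1 : ℝ) ≤ 4 ^ n := one_le_pow₀ (by norm_num)
  refine mul_le_mul (by linarith) (mul_le_of_le_one_right (by positivity) hle) ?_ (by positivity)
  positivity

lemma sum_abs_prob_spike_sub_le {O : Type} (hn : 1 ≤ n) (c : {a : PauliIndex n // a ≠ 0} → ℝ)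
    (hc : ∀ a, |c a| ≤ 1) (S : {a : PauliIndex n // a ≠ 0} → Set O) (𝒜 : Protocol n k O) :
    ∑ a, |𝒜.prob (pauliChannel (spikeRates a.1 (c a))) (S a) - 𝒜.prob (depolarizing n) (S a)| ≤
      𝒜.queries * √(4 ^ n * 2 ^ (n + k)) :=
  𝒜.sum_abs_prob_sub_le (fun a => isPositiveTP_pauliChannel (spikeRates_mem a.2 (hc a)))
    (isPositiveTP_depolarizing hn) (totalDeviationLE_spikes c hc) (Real.sqrt_nonneg _) S

lemma le_queries_of_deviation {η : ℝ} (hη : 0 < η) (hn : 1 ≤ n) {q : ℕ}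
    (h : 4 * η * (4 ^ n - 1) ≤ 2 * (q * √(4 ^ n * 2 ^ (n + k)))) :
    min η 1 * (2 : ℝ) ^ (((n : ℝ) - (k : ℝ)) / 3) ≤ q := by
  have h4 : (4 : ℝ) ≤ 4 ^ n := le_self_pow₀ (by norm_num) (by omega)
  -- Uses `4^n - 1 ≥ 4^n / 2`.
  have h1 : η * 4 ^ n ≤ q * √(4 ^ n * 2 ^ (n + k)) := by nlinarith
  have hq : 1 ≤ q := by
    by_contra! hq
    obtain rfl : q = 0 := by omega
    have : 0 < η * 4 ^ n := by positivity
    simp only [Nat.cast_zero, zero_mul] at h1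
    linarith
  have h2 : η ^ 2 * 2 ^ n ≤ q ^ 2 * 2 ^ k := by
    have := pow_le_pow_left₀ (by positivity) h1 2
    rw [mul_pow, mul_pow, Real.sq_sqrt (by positivity)] at this
    have h42 : (4 : ℝ) ^ n = 2 ^ n * 2 ^ n := by rw [← mul_pow]; norm_num
    -- Squaring `h1` gives `η² 2^(4n) ≤ q² 2^(3n+k)`; the common factor `2^(3n)` is cancelled.
    have hpos : (0 : ℝ) < 2 ^ n * 2 ^ n * 2 ^ n := by positivity
    refine le_of_mul_le_mul_left ?_ hpos
    rw [h42, pow_add] at this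
    linarith
  have hq' : (1 : ℝ) ≤ q := by exact_mod_cast hq
  rcases le_total (n : ℝ) k with hnk | hnk
  · have : (2 : ℝ) ^ (((n : ℝ) - (k : ℝ)) / 3) ≤ 1 :=
      Real.rpow_le_one_of_one_le_of_nonpos (by norm_num) (by linarith)
    exact (mul_le_one₀ (min_le_right _ _) (by positivity) this).trans hq'
  · have h3 : (2 : ℝ) ^ (((n : ℝ) - (k : ℝ)) / 3) ≤ 2 ^ (((n : ℝ) - (k : ℝ)) / 2) :=
      Real.rpow_le_rpow_of_exponent_le (by norm_num) (by linarith)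
    have h5 : ((2 : ℝ) ^ (((n : ℝ) - (k : ℝ)) / 2)) ^ 2 * 2 ^ k = 2 ^ n := by
      rw [← Real.rpow_natCast _ 2, ← Real.rpow_mul (by norm_num), ← Real.rpow_natCast 2 k,
        ← Real.rpow_natCast 2 n, ← Real.rpow_add (by norm_num)]
      congr 1
      push_cast
      ring
    have h6 : η * (2 : ℝ) ^ (((n : ℝ) - (k : ℝ)) / 2) ≤ q := by
      refine (pow_le_pow_iff_left₀ (by positivity) (by positivity) two_ne_zero).1 ?_
      rw [mul_pow]
      refine le_of_mul_le_mul_right (a := (2 : ℝ) ^ k) ?_ (by positivity)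
      rwa [mul_assoc, h5]
    exact (mul_le_mul (min_le_left _ _) h3 (by positivity) hη.le).trans h6

/-- Success means that the answer `true` is on average at least `2δ - 1` more likely under a spike
than under depolarization. -/
lemma deviation_of_solvesSpikeDetection {δ : ℝ} (hn : 1 ≤ n) {𝒜 : Protocol n k Bool}
    (h : SolvesSpikeDetection 𝒜 δ) :
    (2 * δ - 1) * (4 ^ n - 1) ≤ 𝒜.queries * √(4 ^ n * 2 ^ (n + k)) := by
  have h4 : (4 : ℝ) ≤ 4 ^ n := le_self_pow₀ (by norm_num) (by omega)
  have hdev := sum_abs_prob_spike_sub_le hn (fun _ => 1) (by simp) (fun _ => {true}) 𝒜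
  simp only [← spiked_eq] at hdev
  have hle : ∑ a : {a : PauliIndex n // a ≠ 0}, 𝒜.prob (spiked a.1) {true} -
      (4 ^ n - 1) * 𝒜.prob (depolarizing n) {true} ≤
        𝒜.queries * √(4 ^ n * 2 ^ (n + k)) := by
    refine le_trans ?_ hdev
    rw [← card_ne_zero_pauliIndex, ← nsmul_eq_mul, ← Finset.card_univ, ← Finset.sum_const,
      ← Finset.sum_sub_distrib]
    exact Finset.sum_le_sum fun a _ => le_abs_self _
  have hcompl := 𝒜.prob_add_prob_compl (isPositiveTP_depolarizing hn) {true}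
  rw [show ({true}ᶜ : Set Bool) = {false} by ext b; cases b <;> simp] at hcompl
  have hpos : (0 : ℝ) < 4 ^ n - 1 := by linarith
  rw [SolvesSpikeDetection] at h
  have hsum : (2 * δ - 𝒜.prob (depolarizing n) {false}) * (4 ^ n - 1) ≤
      ∑ a : {a : PauliIndex n // a ≠ 0}, 𝒜.prob (spiked a.1) {true} := by
    rw [← le_div_iff₀ hpos]
    linarith
  have : 𝒜.prob (depolarizing n) {false} = 1 - 𝒜.prob (depolarizing n) {true} := by linarith
  rw [this] at hsum
  linarith

/-- For `ε` near `1` an estimate need not separate eigenvalue `1` from `0`, so spikes of both signs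
are used: as `ε ≤ 1`, the sign of the estimate at `a` tells `+1` from `-1`. Under depolarization the
two sign events have total probability `1`, so for each `a` the two deviations add up to at least
`2δ - 1`. -/
lemma deviation_of_solvesEigenvalueEstimation {ε δ : ℝ} (hn : 1 ≤ n) (hε : ε ≤ 1)
    {𝒜 : Protocol n k (PauliIndex n → ℝ)} (h : SolvesEigenvalueEstimation 𝒜 ε δ) :
    (2 * δ - 1) * (4 ^ n - 1) ≤ 2 * (𝒜.queries * √(4 ^ n * 2 ^ (n + k))) := by
  have hp := sum_abs_prob_spike_sub_le hn (fun _ => 1) (by simp)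
    (fun a => {est : PauliIndex n → ℝ | 0 < est a.1}) 𝒜
  have hm := sum_abs_prob_spike_sub_le hn (fun _ => -1) (by simp)
    (fun a => {est : PauliIndex n → ℝ | 0 < est a.1}ᶜ) 𝒜
  rw [two_mul (_ * _), ← card_ne_zero_pauliIndex, mul_comm (2 * δ - 1), ← nsmul_eq_mul,
    ← Finset.card_univ, ← Finset.sum_const]
  refine le_trans ?_ (add_le_add hp hm)
  rw [← Finset.sum_add_distrib]
  refine Finset.sum_le_sum fun a _ => ?_
  have hsp := spikeRates_mem a.2 (c := 1) (by simp)
  have hsm := spikeRates_mem a.2 (c := -1) (by simp)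
  have h1 := (h _ hsp).trans (𝒜.prob_mono (isPositiveTP_pauliChannel hsp)
    (T := {est | 0 < est a.1}) fun est hest => by
      have := (abs_lt.1 (hest a.1)).1
      rw [pauliEigenvalue_spikeRates a.2] at this
      show 0 < est a.1
      linarith)
  have h2 := (h _ hsm).trans (𝒜.prob_mono (isPositiveTP_pauliChannel hsm)
    (T := {est | 0 < est a.1}ᶜ) fun est hest => by
      have := (abs_lt.1 (hest a.1)).2
      rw [pauliEigenvalue_spikeRates a.2] at this
      show ¬ 0 < est a.1
      linarith)
  have h3 := 𝒜.prob_add_prob_compl (isPositiveTP_depolarizing hn) {est | 0 < est a.1}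
  have h4 := le_abs_self (𝒜.prob (pauliChannel (spikeRates a.1 1)) {est | 0 < est a.1} -
    𝒜.prob (depolarizing n) {est | 0 < est a.1})
  have h5 := le_abs_self (𝒜.prob (pauliChannel (spikeRates a.1 (-1))) {est | 0 < est a.1}ᶜ -
    𝒜.prob (depolarizing n) {est | 0 < est a.1}ᶜ)
  linarith

end

end PauliLearning

end

open PauliLearning

theorem theorem4p1 (δ : ℝ) (hδ : 1 / 2 < δ) :
    ∃ c : ℝ, 0 < c ∧ ∀ n k : ℕ, 1 ≤ n →
      (∀ ε : ℝ, 0 < ε → ε ≤ 1 → ∀ 𝒜 : Protocol n k (PauliIndex n → ℝ),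
        SolvesEigenvalueEstimation 𝒜 ε δ →
          c * (2 : ℝ) ^ (((n : ℝ) - (k : ℝ)) / 3) ≤ (𝒜.queries : ℝ)) ∧
      (∀ 𝒜 : Protocol n k Bool, SolvesSpikeDetection 𝒜 δ →
        c * (2 : ℝ) ^ (((n : ℝ) - (k : ℝ)) / 3) ≤ (𝒜.queries : ℝ)) := by
  have hη : 0 < (2 * δ - 1) / 4 := by linarith
  -- The first entry makes `4η = 2δ - 1`; the cap at `1` serves the case `k ≥ n`, where only `q ≥ 1`
  -- is available.
  refine ⟨min ((2 * δ - 1) / 4) 1, lt_min hη one_pos, fun n k hn => ⟨fun ε _ hε 𝒜 h => ?_,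
    fun 𝒜 h => ?_⟩⟩
  · refine le_queries_of_deviation hη hn ?_
    have := deviation_of_solvesEigenvalueEstimation hn hε h
    linarith
  · refine le_queries_of_deviation hη hn ?_
    have := deviation_of_solvesSpikeDetection hn h
    have : 0 ≤ (𝒜.queries : ℝ) * √(4 ^ n * 2 ^ (n + k)) := by positivity
    linarith
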